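/- **Conventions.** A ZX diagram is an open multigraph whose vertices are Z- and X-spiders (with phases in $\frac{\pi}{2}\mathbb Z$) and whose open ends are the inputs and outputs; an edge with an input or output as an end is called an input or output (boundary) edge. A *fault* $F$ on a diagram $D$ with edge set $E$ is an $E$-indexed tensor product of Pauli operators, up to phase; $D^F$ is the linear map obtained from $D$ by placing $F_e$ on each edge $e$. Under *edge-flip noise* the atomic faults are all Paulis acting non-trivially on exactly one edge, and the weight $wt(F)$ is the least number of atomic faults whose product is $F$. A *Pauli web* is a highlighting $P$ of the edges by Paulis ($Z$: green, $X$: red, $Y$: both) such that at each spider of phase $0$ or $\pi$ an even number of legs is highlighted in its own colour (green for Z-spiders, red for X-spiders) and all or none of its legs in the opposite colour, and at each spider of phase $\pm\frac{\pi}{2}$ either an even number of legs in its own colour and none in the opposite colour, or an odd number in its own colour and all in the opposite colour. A *detecting region* is a Pauli web that highlights no input or output edge, and $F$ is *detectable* if it anticommutes with some detecting region. Two diagrams $D_1,D_2$ with the same inputs and outputs are *$w$-fault-equivalent* if every fault $F_1$ on $D_1$ with $wt(F_1)<w$ is detectable or admits a fault $F_2$ on $D_2$ with $wt(F_2)\le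 wt(F_1)$ and $D_1^{F_1}=D_2^{F_2}$ up to a global phase, and likewise with the roles of $D_1$ and $D_2$ exchanged. They are *fault-equivalent* if they are $w$-fault-equivalent for all $w\in\mathbb N$. **Proposition ($\textsc{Fuse-n}_{\text{fe}}$).** Let $n\ge 1$. Let $D_1$ be a single phase-free Z-spider with $2n$ legs, each of which is an input or an output. Let $D_2$ be the following diagram of phase-free Z-spiders with the same inputs and outputs: two $n$-legged spiders $s,s'$ and $n$ pairs $(a_i,b_i)$, $1\le i\le n$, of $3$-legged spiders, with internal edges $s\,a_i$, $a_i\,b_i$ and $b_i\,s'$ for every $i$, and with one boundary edge at each of the $2n$ spiders $a_i$, $b_i$ (in any assignment of the inputs and outputs to these spiders). Then $D_1$ and $D_2$ are fault-equivalent under edge-flip noise, i.e. $w$-fault-equivalent for every $w\in\mathbb N$. -/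

import Mathlib

open scoped BigOperators

namespace ZXFault

noncomputable section

/-! ### Pauli operators up to phase -/

/-- The single-qubit Pauli group modulo phases: `(x, z)` stands for the class of `X ^ x * Z ^ z`,
so that `(0, 0) = I`, `(1, 0) = X`, `(0, 1) = Z` and `(1, 1) = Y`. The product of Paulis is written
additively. -/
abbrev Pauli : Type := ZMod 2 × ZMod 2

/-- The matrix `X ^ x * Z ^ z` representing the class `(x, z)` (`Y` is represented by
`X * Z = -i Y`). -/
def Pauli.toMatrix (P : Pauli) : Matrix (Fin 2) (Fin 2) ℂ :=
  (if P.1 = 1 then !![0, 1; 1, 0] else 1) * (if P.2 = 1 then !![1, 0; 0, -1] else 1)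

/-- The two tensor products of Paulis `F` and `P` anticommute: they do so on an odd number of
tensor factors. -/
def Anticommute {E : Type} [Fintype E] (F P : E → Pauli) : Prop :=
  ∑ e, ((F e).1 * (P e).2 + (F e).2 * (P e).1) = (1 : ZMod 2)

/-! ### ZX diagrams -/

/-- The colour of a spider: Z-spiders are green and X-spiders are red. -/
inductive Colour where
  | green
  | red

/-- A (Clifford) ZX diagram with inputs `I` and outputs `O`: an open multigraph. Every edge has two
half-edges, indexed by `Bool`; each half-edge is attached either to a spider (it is then one of
its legs) or to an input or an output. Parallel edges, self-loops, bare wires, cups and caps are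
allowed. Exactly one half-edge is attached to each input and to each output. A spider `s` carries
the phase `phase s * π / 2`. -/
structure Diagram (I O : Type) where
  Spider : Type
  Edge : Type
  [fintypeSpider : Fintype Spider]
  [fintypeEdge : Fintype Edge]
  colour : Spider → Colour
  phase : Spider → ZMod 4
  ends : Edge → Bool → Spider ⊕ (I ⊕ O)
  existsUnique_boundary : ∀ b : I ⊕ O, ∃! h : Edge × Bool, ends h.1 h.2 = Sum.inr b

attribute [instance] Diagram.fintypeSpider Diagram.fintypeEdge

namespace Diagram

variable {I O : Type}

/-- Half-edges. -/
abbrev HalfEdge (D : Diagram I O) : Type := D.Edge × Bool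

/-- What a half-edge is attached to. -/
abbrev endOf (D : Diagram I O) (h : D.HalfEdge) : D.Spider ⊕ (I ⊕ O) := D.ends h.1 h.2

/-- The legs of a spider. -/
abbrev Leg (D : Diagram I O) (s : D.Spider) : Type := {h : D.HalfEdge // D.endOf h = Sum.inl s}

/-- An edge that has an input or an output as an endpoint. -/
def IsBoundaryEdge (D : Diagram I O) (e : D.Edge) : Prop :=
  ∃ (h : Bool) (b : I ⊕ O), D.ends e h = Sum.inr b

/-- A fault: an element of the Pauli group, modulo phases, on the edges. -/
abbrev Fault (D : Diagram I O) : Type := D.Edge → Pauli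

end Diagram

/-! ### Interpretation as linear maps -/

/-- The basis vectors `|0⟩, |1⟩` (green) or `|+⟩, |-⟩` (red). -/
def Colour.ket : Colour → Fin 2 → Fin 2 → ℂ
  | .green, 0 => ![1, 0]
  | .green, 1 => ![0, 1]
  | .red, 0 => ![1 / (Real.sqrt 2 : ℂ), 1 / (Real.sqrt 2 : ℂ)]
  | .red, 1 => ![1 / (Real.sqrt 2 : ℂ), -(1 / (Real.sqrt 2 : ℂ))]

/-- The entries, at the bits `b` on the legs, of a spider with legs `L` and phase `k * π / 2`:
`|0⟩⊗…⊗|0⟩ + exp (i k π / 2) |1⟩⊗…⊗|1⟩` for a Z-spider, the same with `|+⟩, |-⟩` for an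
X-spider. (As the basis vectors are real, a leg contributes the same factor as an input and as an
output.) -/
def spiderEntry {L : Type} [Fintype L] (c : Colour) (k : ZMod 4) (b : L → Fin 2) : ℂ :=
  ∏ l, c.ket 0 (b l) + Complex.I ^ k.val * ∏ l, c.ket 1 (b l)

namespace Diagram

variable {I O : Type}

open Classical in
/-- The linear map of the diagram obtained from `D` by placing on every edge `e` the Pauli `F e`,
as a matrix whose rows are indexed by the output bits and whose columns by the input bits: sum,
over all assignments of bits to the half-edges which agree with the given bits on inputs and
outputs, of the product of the entries of all spiders and of all the edge operators. -/
def interpWithFault (D : Diagram I O) (F : D.Fault) : Matrix (O → Fin 2) (I → Fin 2) ℂ :=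
  fun o i =>
    ∑ b : D.HalfEdge → Fin 2,
      if ∀ (h : D.HalfEdge) (v : I ⊕ O), D.endOf h = Sum.inr v → b h = Sum.elim i o v then
        (∏ s : D.Spider, spiderEntry (D.colour s) (D.phase s) (fun l : D.Leg s => b l.1)) *
          ∏ e : D.Edge, (F e).toMatrix (b (e, false)) (b (e, true))
      else 0

/-! ### Pauli webs and detectability -/

/-- The component of a highlighting in the given colour: an edge is highlighted in green if the
Pauli is `Z` or `Y`, in red if it is `X` or `Y`. -/
def highlighted : Colour → Pauli → Prop
  | .green, P => P.2 = 1
  | .red, P => P.1 = 1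

/-- The other colour. -/
def opposite : Colour → Colour
  | .green => .red
  | .red => .green

/-- A Pauli web: at every spider, if the phase is `0` or `π`, an even number of legs is highlighted
in the spider's own colour, and all or none are in the opposite colour; if the phase is `± π / 2`,
then either an even number of legs is highlighted in its own colour and none in the opposite
colour, or an odd number in its own colour and all in the opposite colour. -/
def IsPauliWeb (D : Diagram I O) (P : D.Edge → Pauli) : Prop :=
  ∀ s : D.Spider,
    let own : ℕ := Nat.card {l : D.Leg s // highlighted (D.colour s) (P l.1.1)}
    let allOpp : Prop := ∀ l : D.Leg s, highlighted (opposite (D.colour s)) (P l.1.1)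
    let noneOpp : Prop := ∀ l : D.Leg s, ¬ highlighted (opposite (D.colour s)) (P l.1.1)
    if D.phase s = 0 ∨ D.phase s = 2 then
      Even own ∧ (allOpp ∨ noneOpp)
    else
      (Even own ∧ noneOpp) ∨ (Odd own ∧ allOpp)

/-- A detecting region: a Pauli web that highlights no input and no output edge. -/
def IsDetectingRegion (D : Diagram I O) (P : D.Edge → Pauli) : Prop :=
  D.IsPauliWeb P ∧ ∀ e, D.IsBoundaryEdge e → P e = 0

/-- A fault is detectable if it anticommutes with a detecting region. -/
def Detectable (D : Diagram I O) (F : D.Fault) : Prop :=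
  ∃ P, D.IsDetectingRegion P ∧ Anticommute F P

/-! ### Noise models and fault equivalence -/

/-- An adversarial noise model: a set of atomic faults. -/
abbrev NoiseModel (D : Diagram I O) : Type := Set D.Fault

/-- The faults that can occur under a noise model: the group that the atomic faults generate. -/
def possibleFaults (D : Diagram I O) (N : D.NoiseModel) : AddSubgroup D.Fault :=
  AddSubgroup.closure N

/-- The weight of a fault: the least number of atomic faults whose product it is. (Every Pauli is
its own inverse modulo phases, so every element of `possibleFaults` is such a product.) -/
def weight (D : Diagram I O) (N : D.NoiseModel) (F : D.Fault) : ℕ :=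
  sInf {k | ∃ l : List D.Fault, (∀ A ∈ l, A ∈ N) ∧ l.sum = F ∧ l.length = k}

open Classical in
/-- The edge-flip noise model: all Paulis that act non-trivially on exactly one edge. -/
def edgeFlip (D : Diagram I O) : D.NoiseModel :=
  {F | ∃ (e : D.Edge) (P : Pauli), P ≠ 0 ∧ F = Pi.single e P}

end Diagram

/-- Equality of linear maps up to a global phase. -/
def EqUpToPhase {m n : Type} (A B : Matrix m n ℂ) : Prop :=
  ∃ c : ℂ, ‖c‖ = 1 ∧ A = c • B

/-- One direction of `w`-fault equivalence: every possible fault of weight less than `w` on `D₁`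
is detectable or has the same effect as a possible fault on `D₂` of at most the same weight. -/
def WFaultLE {I O : Type} (w : ℕ) (D₁ : Diagram I O) (N₁ : D₁.NoiseModel)
    (D₂ : Diagram I O) (N₂ : D₂.NoiseModel) : Prop :=
  ∀ F₁ ∈ D₁.possibleFaults N₁, D₁.weight N₁ F₁ < w →
    D₁.Detectable F₁ ∨
      ∃ F₂ ∈ D₂.possibleFaults N₂, D₂.weight N₂ F₂ ≤ D₁.weight N₁ F₁ ∧
        EqUpToPhase (D₁.interpWithFault F₁) (D₂.interpWithFault F₂)

/-- `w`-fault equivalence. -/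
def WFaultEquivalent {I O : Type} (w : ℕ) (D₁ : Diagram I O) (N₁ : D₁.NoiseModel)
    (D₂ : Diagram I O) (N₂ : D₂.NoiseModel) : Prop :=
  WFaultLE w D₁ N₁ D₂ N₂ ∧ WFaultLE w D₂ N₂ D₁ N₁

/-- Fault equivalence: `w`-fault equivalence for all `w`. -/
def FaultEquivalent {I O : Type} (D₁ : Diagram I O) (N₁ : D₁.NoiseModel)
    (D₂ : Diagram I O) (N₂ : D₂.NoiseModel) : Prop :=
  ∀ w : ℕ, WFaultEquivalent w D₁ N₁ D₂ N₂

/-! ### The two sides of the rewrite -/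

/-- A single phase-free Z-spider whose legs are the inputs `I` and the outputs `O`. -/
abbrev zSpider (I O : Type) [Fintype I] [Fintype O] : Diagram I O where
  Spider := Unit
  Edge := I ⊕ O
  colour _ := .green
  phase _ := 0
  ends e h := match h with
    | false => Sum.inl ()
    | true => Sum.inr e
  existsUnique_boundary := by
    intro b
    refine ⟨(b, true), rfl, ?_⟩
    rintro ⟨e, h⟩ he
    cases h
    · cases he
    · cases he
      rfl

/-- The spiders of the decomposed spider: two central ones, and `n` pairs
`outer false i`, `outer true i`. -/
inductive SplitSpider (n : ℕ) where
  | central (c : Bool)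
  | outer (c : Bool) (i : Fin n)
  deriving Fintype

/-- The edges of the decomposed spider: for each `i < n`, the edge `spoke c i` from `central c`
to `outer c i`, the edge `link i` between `outer false i` and `outer true i`, and the boundary edge
`leg c i` at `outer c i`. -/
inductive SplitEdge (n : ℕ) where
  | spoke (c : Bool) (i : Fin n)
  | link (i : Fin n)
  | leg (c : Bool) (i : Fin n)
  deriving Fintype

/-- The decomposition of a `2n`-legged Z-spider into two `n`-legged Z-spiders joined through `n`
pairs of 3-legged Z-spiders (all phase-free): the two members of the `i`-th pair are joined to each
other, one of them is joined to the first `n`-legged spider, the other one to the second, and each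
has one of the `2n` boundary edges. The bijection `b` says which outer spider carries which input
or output. -/
abbrev splitSpider {I O : Type} (n : ℕ) (b : I ⊕ O ≃ Bool × Fin n) : Diagram I O where
  Spider := SplitSpider n
  Edge := SplitEdge n
  colour _ := .green
  phase _ := 0
  ends e h := match e, h with
    | .spoke c _, false => Sum.inl (.central c)
    | .spoke c i, true => Sum.inl (.outer c i)
    | .link i, h => Sum.inl (.outer h i)
    | .leg c i, false => Sum.inl (.outer c i)
    | .leg c i, true => Sum.inr (b.symm (c, i))
  existsUnique_boundary := by
    intro v
    refine ⟨(.leg (b v).1 (b v).2, true), ?_, ?_⟩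
    · simp
    · rintro ⟨e, h⟩ he
      cases e <;> cases h <;> simp at he
      subst he
      simp

end

end ZXFault

/-!
A phase-free Z-spider forces the bits on all its legs to agree, so the interpretation of a diagram
of such spiders is a sum over one bit per spider (`interpWithFault_eq_sum`). The `X`-part of a
fault prescribes, on every edge, whether the bits at its two ends differ; the `Z`-part only
contributes signs.

On the decomposed spider, every hexagon through two of the pairs, highlighted in green, is a
detecting region. Hence the `X`-part of an undetectable fault on the internal edges is the
coboundary of a bit assignment `x` to the spiders (`exists_isPotential_of_not_detectable`), and the
sum has only two terms, `x` and its complement. Up to a global sign the effect of the fault is thus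
determined by the set `S` of boundary edges that are effectively flipped and by the parity `p` of
the `Z`-part (`flipMatrix`), where `S` may be replaced by its complement. The effect of a fault on
the single spider has the same form, so it remains to realise `S` or its complement, together with
`p`, by a fault on the `2n` legs without raising the weight, which is the size of the support
(`weight_edgeFlip`).

If `x` takes the same value at both central spiders, every outer spider at which `x` takes the
other value can be charged to an edge of its own pair at which `x` changes. If the central values
differ, `x` changes along each of the `n` paths between them, so the weight is at least `n`, and
one of `S` and its complement has at most `n` elements. The parity `p` is then put on a leg which
is flipped anyway; if there is none, an odd parity costs one leg, and the original fault, having a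
non-trivial `Z`-part, has weight at least one as well.
-/

namespace ZXFault

open Finset

noncomputable section

/-! ### Weights under edge-flip noise -/

section Weight

variable {I O : Type} (D : Diagram I O)

theorem mem_possibleFaults_edgeFlip (F : D.Fault) : F ∈ D.possibleFaults D.edgeFlip := by
  classical
  rw [← Finset.univ_sum_single F]
  refine AddSubgroup.sum_mem _ fun e _ => ?_
  by_cases h : F e = 0
  · rw [h, Pi.single_zero]
    exact AddSubgroup.zero_mem _
  · refine AddSubgroup.subset_closure ⟨e, F e, h, ?_⟩
    congr!

/-- A product of `k` atomic faults acts on at most `k` edges. -/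
theorem card_support_sum_le_length (l : List D.Fault) (hl : ∀ A ∈ l, A ∈ D.edgeFlip) :
    #{e | l.sum e ≠ 0} ≤ l.length := by
  classical
  induction l with
  | nil => simp
  | cons A l ih =>
    obtain ⟨e₀, P, -, rfl⟩ := hl A (by simp)
    have hsub : ({e | (Pi.single e₀ P + l.sum : D.Fault) e ≠ 0} : Finset D.Edge) ⊆
        insert e₀ ({e | l.sum e ≠ 0} : Finset D.Edge) := by
      intro e he
      by_cases h : e = e₀
      · simp [h]
      · simpa [h, Pi.single_apply] using he
    have h₁ := (card_le_card hsub).trans (card_insert_le _ _)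
    have h₂ := ih fun B hB => hl B (by simp [hB])
    rw [List.sum_cons, List.length_cons]
    exact h₁.trans (Nat.succ_le_succ h₂)

theorem weight_edgeFlip (F : D.Fault) : D.weight D.edgeFlip F = #{e | F e ≠ 0} := by
  classical
  have hmem : #{e | F e ≠ 0} ∈
      {k | ∃ l : List D.Fault, (∀ A ∈ l, A ∈ D.edgeFlip) ∧ l.sum = F ∧ l.length = k} := by
    refine ⟨({e | F e ≠ 0} : Finset D.Edge).toList.map fun e => Pi.single e (F e), ?_, ?_, ?_⟩
    · intro A hA
      simp only [List.mem_map, mem_toList, mem_filter_univ] at hA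
      obtain ⟨e, he, rfl⟩ := hA
      exact ⟨e, F e, he, by congr!⟩
    · rw [sum_map_toList, sum_filter_of_ne, Finset.univ_sum_single]
      intro e _ he h
      exact he (by rw [h, Pi.single_zero])
    · simp
  refine le_antisymm (Nat.sInf_le hmem) (le_csInf ⟨_, hmem⟩ ?_)
  rintro k ⟨l, hl, rfl, rfl⟩
  exact card_support_sum_le_length D l hl

end Weight

/-! ### Diagrams of phase-free Z-spiders -/

/-- The sign `(-1) ^ a` of a bit. -/
def sign (a : ZMod 2) : ℂ := if a = 0 then 1 else -1

theorem bit_cases : ∀ a : ZMod 2, a = 0 ∨ a = 1 := by decide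

theorem sign_zero : sign 0 = 1 := by simp [sign]

theorem sign_add (a b : ZMod 2) : sign (a + b) = sign a * sign b := by
  rcases bit_cases a with rfl | rfl <;> rcases bit_cases b with rfl | rfl <;>
    simp [sign, CharTwo.add_self_eq_zero]

theorem sign_sum {ι : Type} (s : Finset ι) (f : ι → ZMod 2) :
    sign (∑ i ∈ s, f i) = ∏ i ∈ s, sign (f i) := by
  classical
  induction s using Finset.induction_on with
  | empty => simp [sign_zero]
  | insert i s hi ih => rw [sum_insert hi, prod_insert hi, sign_add, ih]

theorem norm_sign (a : ZMod 2) : ‖sign a‖ = 1 := by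
  unfold sign
  split_ifs <;> simp

theorem toMatrix_apply (P : Pauli) (a b : ZMod 2) :
    P.toMatrix a b = if a + b = P.1 then sign (P.2 * b) else 0 := by
  obtain ⟨x, z⟩ := P
  rcases bit_cases x with rfl | rfl <;> rcases bit_cases z with rfl | rfl <;>
    simp only [Pauli.toMatrix, zero_ne_one, if_true, if_false, mul_one, one_mul] <;>
    fin_cases a <;> fin_cases b <;> simp [Matrix.mul_apply, Fin.sum_univ_two] <;>
    first | rfl | exact fun h => absurd h (by decide)

theorem spiderEntry_green_zero {L : Type} [Fintype L] (b : L → Fin 2) :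
    spiderEntry .green 0 b = ∑ c : Fin 2, if ∀ l, b l = c then 1 else 0 := by
  have h : ∀ c k : Fin 2, Colour.green.ket c k = if k = c then 1 else 0 := by
    intro c k
    fin_cases c <;> fin_cases k <;> simp [Colour.ket]
  simp only [spiderEntry, h, Fintype.prod_ite_zero, Fin.sum_univ_two]
  simp

open Classical in
/-- A Z-spider without legs is the scalar `2`, which is the sum over its unconstrained bit; so no
assumption on the legs is needed. -/
theorem interpWithFault_eq_sum {I O : Type} (D : Diagram I O)
    (hc : ∀ s, D.colour s = .green) (hp : ∀ s, D.phase s = 0) (F : D.Fault)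
    (o : O → Fin 2) (i : I → Fin 2) :
    D.interpWithFault F o i = ∑ x : D.Spider → Fin 2, ∏ e, (F e).toMatrix
      (Sum.elim x (Sum.elim i o) (D.ends e false)) (Sum.elim x (Sum.elim i o) (D.ends e true)) := by
  classical
  have hspider : ∀ b : D.HalfEdge → Fin 2,
      ∏ s, spiderEntry (D.colour s) (D.phase s) (fun l : D.Leg s => b l.1) =
        ∑ x : D.Spider → Fin 2, if ∀ s, ∀ l : D.Leg s, b l.1 = x s then 1 else 0 := by
    intro b
    simp only [hc, hp, spiderEntry_green_zero]
    rw [Fintype.prod_sum]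
    refine Finset.sum_congr rfl fun x _ => ?_
    rw [Fintype.prod_ite_zero]
    simp
  simp only [Diagram.interpWithFault, hspider]
  have hpush : ∀ b : D.HalfEdge → Fin 2,
      (if ∀ (h : D.HalfEdge) (v : I ⊕ O), D.endOf h = Sum.inr v → b h = Sum.elim i o v then
        (∑ x : D.Spider → Fin 2, if ∀ s, ∀ l : D.Leg s, b l.1 = x s then (1 : ℂ) else 0) *
          ∏ e : D.Edge, (F e).toMatrix (b (e, false)) (b (e, true)) else 0) =
      ∑ x : D.Spider → Fin 2, if b = fun h => Sum.elim x (Sum.elim i o) (D.endOf h) then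
        ∏ e : D.Edge, (F e).toMatrix (b (e, false)) (b (e, true)) else 0 := by
    intro b
    have hiff : ∀ x : D.Spider → Fin 2,
        (b = fun h => Sum.elim x (Sum.elim i o) (D.endOf h)) ↔
          (∀ (h : D.HalfEdge) (v : I ⊕ O), D.endOf h = Sum.inr v → b h = Sum.elim i o v) ∧
            ∀ s, ∀ l : D.Leg s, b l.1 = x s := by
      intro x
      constructor
      · rintro rfl
        exact ⟨fun h v hv => by simp [hv], fun s l => by simp [l.2]⟩
      · rintro ⟨hb, hx⟩
        funext h
        rcases hh : D.endOf h with s | v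
        · exact hx s ⟨h, hh⟩
        · exact hb h v hh
    simp only [hiff, ite_and, Finset.sum_mul, ite_mul, one_mul, zero_mul]
    split_ifs <;> simp
  simp only [hpush]
  rw [Finset.sum_comm]
  refine Finset.sum_congr rfl fun x _ => ?_
  rw [Finset.sum_ite_eq' Finset.univ]
  simp

open Classical in
/-- The interpretation as a sum over the bits `x` on the spiders for which the `X`-part of the fault
is the difference of the bits at the two ends of every edge; the `Z`-part gives the sign. -/
theorem interpWithFault_eq_sum_sign {I O : Type} (D : Diagram I O)
    [inst : DecidableEq D.Spider] (hc : ∀ s, D.colour s = .green) (hp : ∀ s, D.phase s = 0)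
    (F : D.Fault) (w : I ⊕ O → ZMod 2) :
    D.interpWithFault F (fun v => w (.inr v)) (fun v => w (.inl v)) =
      ∑ x : D.Spider → ZMod 2,
        if ∀ e, Sum.elim x w (D.ends e false) + Sum.elim x w (D.ends e true) = (F e).1 then
          sign (∑ e, (F e).2 * Sum.elim x w (D.ends e true)) else 0 := by
  obtain rfl : inst = fun _ _ => Classical.propDecidable _ := Subsingleton.elim _ _
  refine (interpWithFault_eq_sum D hc hp F _ _).trans ?_
  refine Fintype.sum_equiv (Equiv.refl _) _ _ fun x => ?_
  have hw : Sum.elim (fun v => w (.inl v)) (fun v => w (.inr v)) = w := by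
    funext v
    cases v <;> rfl
  have hprod : ∀ a b : D.Edge → ZMod 2, ∏ e, (F e).toMatrix (a e) (b e) =
      if ∀ e, a e + b e = (F e).1 then sign (∑ e, (F e).2 * b e) else 0 := by
    intro a b
    simp only [toMatrix_apply]
    rw [Fintype.prod_ite_zero]
    simp only [sign_sum]
  rw [← hprod, ← hw]
  rfl

/-! ### Effects of faults -/

section Effect

variable {I O : Type}

open Classical in
/-- A phase-free Z-spider with legs `I ⊕ O` on which the legs in `S` are flipped by an `X`, and
`Z` acts on the common bit `c` of its legs if the parity `p` is odd. -/
def flipMatrix (S : I ⊕ O → ZMod 2) (p : ZMod 2) : Matrix (O → Fin 2) (I → Fin 2) ℂ :=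
  fun o i => ∑ c : ZMod 2,
    if ∀ v, c + (Sum.elim i o : I ⊕ O → ZMod 2) v = S v then sign (p * c) else 0

/-- The stabiliser `X ⊗ … ⊗ X` of the Z-spider: flipping a set of legs has the same effect as
flipping its complement. -/
theorem flipMatrix_add_one (S : I ⊕ O → ZMod 2) (p : ZMod 2) :
    flipMatrix (fun v => S v + 1) p = sign p • flipMatrix S p := by
  classical
  ext o i
  simp only [flipMatrix, Matrix.smul_apply, smul_eq_mul, Finset.mul_sum, mul_ite, mul_zero]
  refine (Fintype.sum_equiv (Equiv.addRight (1 : ZMod 2)) _ _ fun c => ?_).symm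
  simp only [Equiv.coe_addRight]
  refine if_congr (forall_congr' fun v => ?_) ?_ rfl
  · rw [add_right_comm, add_left_inj]
  · rw [mul_add, mul_one, add_comm, sign_add]

/-- The `Z`-part of a fault on the single spider acts on the flipped bits of the legs, which gives a
global sign besides the parity. -/
theorem interpWithFault_zSpider [Fintype I] [Fintype O] (F : (zSpider I O).Fault) :
    (zSpider I O).interpWithFault F =
      sign (∑ v, (F v).2 * (F v).1) • flipMatrix (fun v => (F v).1) (∑ v, (F v).2) := by
  classical
  ext o i
  simp only [flipMatrix, Matrix.smul_apply, smul_eq_mul, Finset.mul_sum, mul_ite, mul_zero]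
  refine (interpWithFault_eq_sum_sign (zSpider I O) (fun _ => rfl) (fun _ => rfl) F
    (Sum.elim i o)).trans ?_
  refine Fintype.sum_equiv (Equiv.funUnique Unit (ZMod 2)) _ _ fun x => ?_
  refine ite_congr rfl (fun h => ?_) fun _ => rfl
  rw [← sign_add, Finset.sum_mul, ← Finset.sum_add_distrib]
  refine congrArg sign (Finset.sum_congr rfl fun (v : I ⊕ O) _ => ?_)
  have aux : ∀ c w s z : ZMod 2, c + w = s → z * w = z * s + z * c := by decide
  exact aux _ _ _ _ (h v)

variable {n : ℕ} (b : I ⊕ O ≃ Bool × Fin n)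

/-- `x` assigns bits to the spiders of the decomposed spider such that the fault `F` acts with an
`X` or a `Y` on exactly those internal edges along which `x` changes. -/
def IsPotential (F : SplitEdge n → Pauli) (x : SplitSpider n → ZMod 2) : Prop :=
  (∀ c i, x (.central c) + x (.outer c i) = (F (.spoke c i)).1) ∧
    ∀ i, x (.outer false i) + x (.outer true i) = (F (.link i)).1

/-- The bit on the boundary edge at `v` when the spiders carry the bits `x` and the `X`-part of `F`
flips the edges. -/
def flipSet (F : SplitEdge n → Pauli) (x : SplitSpider n → ZMod 2) (v : I ⊕ O) : ZMod 2 :=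
  x (.outer (b v).1 (b v).2) + (F (.leg (b v).1 (b v).2)).1

/-- Two potentials of the same fault agree up to complement, since the graph is connected. -/
theorem IsPotential.eq_add_const {F : SplitEdge n → Pauli} {x y : SplitSpider n → ZMod 2}
    (hn : 1 ≤ n) (hx : IsPotential F x) (hy : IsPotential F y) (s : SplitSpider n) :
    y s = x s + (x (.central false) + y (.central false)) := by
  have aux : ∀ p q r t d : ZMod 2, p + q = r + t → r = p + d → t = q + d := by decide
  have hcf : y (.central false) =
      x (.central false) + (x (.central false) + y (.central false)) := by
    rw [← add_assoc, CharTwo.add_self_eq_zero, zero_add]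
  have hf := fun i => aux _ _ _ _ _ ((hx.1 false i).trans (hy.1 false i).symm) hcf
  have ht := fun i => aux _ _ _ _ _ ((hx.2 i).trans (hy.2 i).symm) (hf i)
  rcases s with (_ | _) | ⟨_ | _, i⟩
  · exact hcf
  · have h := (hx.1 true ⟨0, hn⟩).trans (hy.1 true ⟨0, hn⟩).symm
    rw [add_comm, add_comm (y _)] at h
    exact aux _ _ _ _ _ h (ht _)
  · exact hf i
  · exact ht i

/-- Only the potential `x` and its complement contribute to the sum over the bits on the spiders, and
passing to the complement multiplies the sign by that of the parity of the `Z`-part. -/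
theorem IsPotential.interpWithFault_splitSpider {F : SplitEdge n → Pauli}
    {x : SplitSpider n → ZMod 2} (hn : 1 ≤ n) (hx : IsPotential F x) :
    ∃ k, (splitSpider n b).interpWithFault F =
      sign k • flipMatrix (flipSet b F x) (∑ e, (F e).2) := by
  classical
  set t : SplitEdge n → ZMod 2 := fun e =>
    Sum.elim x (flipSet b F x) ((splitSpider n b).ends e true) with ht
  refine ⟨∑ e, (F e).2 * t e, ?_⟩
  ext o i
  set w : I ⊕ O → ZMod 2 := Sum.elim i o with hw
  refine (interpWithFault_eq_sum_sign (splitSpider n b) (fun _ => rfl) (fun _ => rfl) F w).trans ?_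
  simp only [flipMatrix, Matrix.smul_apply, smul_eq_mul, Finset.mul_sum, mul_ite, mul_zero]
  symm
  refine Fintype.sum_of_injective (fun c s => x s + c) ?_ _ _ ?_ ?_
  · intro c d h
    simpa using congrFun h (.central false)
  · intro y hy
    refine if_neg fun h => hy ⟨x (.central false) + y (.central false), ?_⟩
    have hy' : IsPotential F y := ⟨fun c j => h (.spoke c j), fun j => h (.link j)⟩
    funext s
    exact (hx.eq_add_const hn hy' s).symm
  · intro c
    have hadd : ∀ p q : ZMod 2, p + c + (q + c) = p + q := by decide +revert
    have hiff : (∀ v, c + w v = flipSet b F x v) ↔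
        ∀ e, Sum.elim (fun s => x s + c) w ((splitSpider n b).ends e false) +
          Sum.elim (fun s => x s + c) w ((splitSpider n b).ends e true) = (F e).1 := by
      have aux : ∀ p q r s : ZMod 2, p + q = r + s ↔ r + p + q = s := by decide
      constructor
      · intro h e
        cases e with
        | spoke d j => exact (hadd _ _).trans (hx.1 d j)
        | link j => exact (hadd _ _).trans (hx.2 j)
        | leg d j =>
          have := (aux _ _ _ _).1 (h (b.symm (d, j)))
          simpa using this
      · intro h v
        have := h (.leg (b v).1 (b v).2)
        refine (aux _ _ _ _).2 ?_
        simpa using this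
    refine ite_congr (propext hiff) (fun h => ?_) fun _ => rfl
    rw [← sign_add, Finset.sum_mul, ← Finset.sum_add_distrib]
    congr 1
    refine Finset.sum_congr rfl fun e _ => ?_
    rw [← mul_add]
    congr 1
    cases e with
    | spoke d j => rfl
    | link j => rfl
    | leg d j =>
      have aux : ∀ p q r : ZMod 2, p + q = r → r + p = q := by decide
      exact aux _ _ _ (hiff.2 h (b.symm (d, j)))

end Effect

/-! ### Undetectable faults -/

section Detectable

variable {I O : Type} {n : ℕ}

/-- The edges of the decomposed spider, sorted by their kind. -/
def splitEdgeEquiv (n : ℕ) :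
    ((Fin n ⊕ Fin n) ⊕ Fin n) ⊕ (Fin n ⊕ Fin n) ≃ SplitEdge n where
  toFun
    | .inl (.inl (.inl i)) => .spoke false i
    | .inl (.inl (.inr i)) => .spoke true i
    | .inl (.inr i) => .link i
    | .inr (.inl i) => .leg false i
    | .inr (.inr i) => .leg true i
  invFun
    | .spoke false i => .inl (.inl (.inl i))
    | .spoke true i => .inl (.inl (.inr i))
    | .link i => .inl (.inr i)
    | .leg false i => .inr (.inl i)
    | .leg true i => .inr (.inr i)
  left_inv := by rintro (((i | i) | i) | (i | i)) <;> rfl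
  right_inv := by rintro (⟨_ | _, i⟩ | i | ⟨_ | _, i⟩) <;> rfl

theorem sum_splitEdge {M : Type} [AddCommMonoid M] (f : SplitEdge n → M) :
    ∑ e, f e = ∑ i, (f (.spoke false i) + f (.spoke true i) + f (.link i) +
      (f (.leg false i) + f (.leg true i))) := by
  rw [← (splitEdgeEquiv n).sum_comp]
  simp only [Fintype.sum_sum_type, Finset.sum_add_distrib]
  rfl

theorem even_card_iff_sum_eq_zero {α : Type} [Fintype α] (f : α → ZMod 2) :
    Even (Nat.card {a // f a = 1}) ↔ ∑ a, f a = 0 := by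
  classical
  have h : ∀ a, f a = if f a = 1 then 1 else 0 := by
    intro a
    rcases bit_cases (f a) with h | h <;> simp [h]
  rw [Finset.sum_congr rfl fun a _ => h a, Finset.sum_boole, Nat.card_eq_fintype_card,
    Fintype.card_subtype, ZMod.natCast_eq_zero_iff_even]

/-- The `i`-th and the `j`-th path between the central spiders form a hexagon; highlighted in
green, it is a detecting region (it is empty for `i = j`). -/
def hexagon (i j : Fin n) : SplitEdge n → Pauli
  | .spoke _ k => (0, (if k = i then 1 else 0) + if k = j then 1 else 0)
  | .link k => (0, (if k = i then 1 else 0) + if k = j then 1 else 0)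
  | .leg _ _ => 0

theorem isDetectingRegion_hexagon (b : I ⊕ O ≃ Bool × Fin n) (i j : Fin n) :
    (splitSpider n b).IsDetectingRegion (hexagon i j) := by
  classical
  have hred : ∀ e, (hexagon i j e).1 = 0 := by rintro (_ | _ | _) <;> rfl
  refine ⟨fun s => ?_, ?_⟩
  · simp only [true_or, if_true]
    refine ⟨?_, Or.inr fun l => ?_⟩
    · refine (even_card_iff_sum_eq_zero fun l : (splitSpider n b).Leg s =>
        (hexagon i j l.1.1).2).2 ?_
      rw [← Finset.sum_subtype (Finset.univ.filter fun h => (splitSpider n b).endOf h = .inl s)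
        (fun h => by simp) (fun h => (hexagon i j h.1).2), Finset.sum_filter,
        Fintype.sum_prod_type, sum_splitEdge]
      have h₁ : ∀ c k, (splitSpider n b).endOf (.spoke c k, false) = .inl (.central c) :=
        fun _ _ => rfl
      have h₂ : ∀ c k, (splitSpider n b).endOf (.spoke c k, true) = .inl (.outer c k) :=
        fun _ _ => rfl
      simp only [Fintype.sum_bool, h₁, h₂]
      rcases s with (_ | _) | ⟨_ | _, k⟩ <;>
        simp [hexagon, Finset.sum_add_distrib, CharTwo.add_self_eq_zero]
    · change ¬ (hexagon i j l.1.1).1 = 1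
      rw [hred]
      decide
  · rintro (⟨c, k⟩ | k | ⟨c, k⟩) ⟨h, v, hv⟩
    · cases h <;> cases hv
    · cases hv
    · rfl

/-- The `X`-part of an undetectable fault has even overlap with every hexagon; integrating it along the
paths from `central false` therefore gives a well-defined bit at each spider. -/
theorem exists_isPotential_of_not_detectable (b : I ⊕ O ≃ Bool × Fin n) (hn : 1 ≤ n)
    {F : SplitEdge n → Pauli} (hF : ¬ (splitSpider n b).Detectable F) :
    ∃ x, IsPotential F x := by
  classical
  -- The value of the potential at `central true`, computed along the `i`-th path, is independent
  -- of `i`.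
  have hcycle : ∀ i j, (F (.spoke false i)).1 + (F (.link i)).1 + (F (.spoke true i)).1 =
      (F (.spoke false j)).1 + (F (.link j)).1 + (F (.spoke true j)).1 := by
    intro i j
    by_contra hne
    refine hF ⟨hexagon i j, isDetectingRegion_hexagon b i j, ?_⟩
    have aux : ∀ p q r p' q' r' : ZMod 2, p + q + r ≠ p' + q' + r' →
        p + p' + (r + r') + (q + q') = 1 := by decide
    rw [Anticommute, sum_splitEdge]
    simp only [hexagon, mul_zero, add_zero, Prod.fst_zero, Prod.snd_zero, mul_add, mul_ite,
      mul_one, Finset.sum_add_distrib, Finset.sum_ite_eq', Finset.mem_univ, if_true]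
    exact aux _ _ _ _ _ _ hne
  let y : Fin n → ZMod 2 := fun i => (F (.spoke false i)).1 + (F (.link i)).1
  refine ⟨fun
    | .central false => 0
    | .outer false i => (F (.spoke false i)).1
    | .outer true i => y i
    | .central true => y ⟨0, hn⟩ + (F (.spoke true ⟨0, hn⟩)).1, ?_, ?_⟩
  · rintro (_ | _) i
    · exact zero_add _
    · change y ⟨0, hn⟩ + (F (.spoke true ⟨0, hn⟩)).1 + y i = _
      rw [← hcycle i ⟨0, hn⟩]
      have aux : ∀ p q : ZMod 2, p + q + p = q := by decide
      exact aux _ _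
  · intro i
    have aux : ∀ p q : ZMod 2, p + (p + q) = q := by decide
    exact aux _ _

end Detectable

/-! ### Weights of effects -/

section WeightBound

variable {I O : Type} {n : ℕ}

theorem card_ne_zero_eq_sum_val {α : Type} [Fintype α] (f : α → ZMod 2) :
    #{a | f a ≠ 0} = ∑ a, (f a).val := by
  rw [Finset.card_filter]
  refine Finset.sum_congr rfl fun a _ => ?_
  rcases bit_cases (f a) with h | h <;> rw [h] <;> rfl

/-- The edge expansion of the decomposed spider: `x`, or its complement, costs at least as many
edges as it flips boundary edges. -/
theorem IsPotential.card_flipSet_le [Fintype I] [Fintype O] (b : I ⊕ O ≃ Bool × Fin n)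
    {F : SplitEdge n → Pauli} {x : SplitSpider n → ZMod 2} (hx : IsPotential F x) :
    ∃ a : ZMod 2, #{v | flipSet b F x v + a ≠ 0} ≤ #{e | F e ≠ 0} := by
  have hcard : #{e | (F e).1 ≠ 0} ≤ #{e | F e ≠ 0} :=
    card_le_card (monotone_filter_right _ fun e _ h h' => h (by rw [h']; rfl))
  suffices ∃ a : ZMod 2, #{v | flipSet b F x v + a ≠ 0} ≤ #{e | (F e).1 ≠ 0} from
    this.imp fun a ha => ha.trans hcard
  have hS : ∀ a : ZMod 2, #{v | flipSet b F x v + a ≠ 0} =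
      ∑ i, ((x (.outer false i) + (F (.leg false i)).1 + a).val +
        (x (.outer true i) + (F (.leg true i)).1 + a).val) := by
    intro a
    rw [card_ne_zero_eq_sum_val, ← b.symm.sum_comp, Fintype.sum_prod_type, Fintype.sum_bool,
      add_comm, ← Finset.sum_add_distrib]
    simp [flipSet]
  simp only [hS]
  rw [card_ne_zero_eq_sum_val, sum_splitEdge]
  simp only [← hx.1, ← hx.2]
  generalize x (.central false) = u, x (.central true) = u'
  by_cases hu : u = u'
  · subst hu
    -- Flip by the common central value, and compare pair by pair.
    refine ⟨u, Finset.sum_le_sum fun i _ => ?_⟩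
    generalize x (.outer false i) = p, x (.outer true i) = q, (F (.leg false i)).1 = r,
      (F (.leg true i)).1 = s
    revert u p q r s
    decide
  · -- Every path contributes at least one edge, whereas `S` and its complement together have two
    -- elements per path.
    by_contra! h
    have h₀ := h 0
    have h₁ := h 1
    have hadd := Finset.sum_le_sum fun i (_ : i ∈ Finset.univ) =>
      show (x (.outer false i) + (F (.leg false i)).1 + 0).val +
          (x (.outer true i) + (F (.leg true i)).1 + 0).val +
          ((x (.outer false i) + (F (.leg false i)).1 + 1).val +
          (x (.outer true i) + (F (.leg true i)).1 + 1).val) ≤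
        2 * ((u + x (.outer false i)).val + (u' + x (.outer true i)).val +
          (x (.outer false i) + x (.outer true i)).val +
          ((F (.leg false i)).1.val + (F (.leg true i)).1.val)) by
        generalize x (.outer false i) = p, x (.outer true i) = q, (F (.leg false i)).1 = r,
          (F (.leg true i)).1 = s
        clear h h₀ h₁
        revert u u' p q r s
        decide
    rw [Finset.sum_add_distrib, ← Finset.mul_sum] at hadd
    omega

/-- Every effect is that of a fault on the single spider which acts on the flipped legs only, except
that an odd parity needs one leg if no leg is flipped. -/
theorem exists_fault_zSpider [Fintype I] [Fintype O] [Nonempty (I ⊕ O)] (S : I ⊕ O → ZMod 2)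
    (p : ZMod 2) : ∃ F : (zSpider I O).Fault, (∀ v, (F v).1 = S v) ∧ ∑ v, (F v).2 = p ∧
      #{v | F v ≠ 0} ≤ max #{v | S v ≠ 0} p.val := by
  classical
  -- `v₀` is the leg that carries the parity.
  obtain ⟨v₀, hv₀⟩ : ∃ v₀, (∃ v, S v ≠ 0) → S v₀ ≠ 0 := by
    by_cases h : ∃ v, S v ≠ 0
    · exact h.imp fun v hv _ => hv
    · exact ⟨Classical.arbitrary _, fun h' => absurd h' h⟩
  refine ⟨fun v => (S v, if v = v₀ then p else 0), fun v => rfl, by simp, ?_⟩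
  by_cases h : ∃ v, S v ≠ 0
  · refine le_max_of_le_left (card_le_card (monotone_filter_right _ fun v _ hv hS => hv ?_))
    have : v ≠ v₀ := fun hvv => hv₀ h (hvv ▸ hS)
    simp [hS, this]
  · push Not at h
    refine le_max_of_le_right ?_
    rcases bit_cases p with rfl | rfl
    · simp [h]
    · refine (card_le_card (t := {v₀}) fun v hv => ?_).trans (by simp; decide)
      by_contra hne
      simp [h] at hv hne
      exact hne hv

end WeightBound

theorem EqUpToPhase.of_sign_smul {m n : Type} {A B M : Matrix m n ℂ} {k l : ZMod 2}
    (hA : A = sign k • M) (hB : B = sign l • M) : EqUpToPhase A B := by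
  refine ⟨sign (k + l), norm_sign _, ?_⟩
  rw [hA, hB, smul_smul, ← sign_add, add_assoc, CharTwo.add_self_eq_zero, add_zero]

/-! ### Fault equivalence -/

section FaultEquivalence

variable {I O : Type} [Fintype I] [Fintype O] {n : ℕ} (b : I ⊕ O ≃ Bool × Fin n)

/-- A fault on the single spider is simulated by the same fault on the boundary edges of the decomposed
spider. -/
theorem wFaultLE_zSpider_splitSpider (hn : 1 ≤ n) (w : ℕ) :
    WFaultLE w (zSpider I O) (zSpider I O).edgeFlip
      (splitSpider n b) (splitSpider n b).edgeFlip := by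
  classical
  intro F _ _
  let G : SplitEdge n → Pauli
    | .leg c i => F (b.symm (c, i))
    | _ => 0
  have hsum : ∀ {M : Type} [AddCommMonoid M] (f : Pauli → M), f 0 = 0 →
      ∑ e, f (G e) = ∑ v, f (F v) := by
    intro M _ f hf
    rw [sum_splitEdge, ← b.symm.sum_comp, Fintype.sum_prod_type, Fintype.sum_bool, add_comm,
      ← Finset.sum_add_distrib]
    simp [G, hf]
  refine Or.inr ⟨G, mem_possibleFaults_edgeFlip _ _, ?_, ?_⟩
  · rw [weight_edgeFlip, weight_edgeFlip, Finset.card_filter, Finset.card_filter]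
    exact (hsum (fun P => if P ≠ 0 then 1 else 0) (by simp)).le
  · have hG : IsPotential G 0 := ⟨fun _ _ => add_zero 0, fun _ => add_zero 0⟩
    obtain ⟨k, hk⟩ := hG.interpWithFault_splitSpider b hn
    have hS : flipSet b G 0 = fun v => (F v).1 := by
      funext v
      simp [flipSet, G]
    rw [hS, hsum Prod.snd rfl] at hk
    exact .of_sign_smul (interpWithFault_zSpider F) hk

theorem wFaultLE_splitSpider_zSpider (hn : 1 ≤ n) (w : ℕ) :
    WFaultLE w (splitSpider n b) (splitSpider n b).edgeFlip
      (zSpider I O) (zSpider I O).edgeFlip := by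
  classical
  intro F _ _
  refine or_iff_not_imp_left.2 fun hF => ?_
  have : Nonempty (I ⊕ O) := ⟨b.symm (false, ⟨0, hn⟩)⟩
  obtain ⟨x, hx⟩ := exists_isPotential_of_not_detectable b hn hF
  obtain ⟨k, hk⟩ := hx.interpWithFault_splitSpider b hn
  obtain ⟨a, ha⟩ := hx.card_flipSet_le b
  obtain ⟨G, hG₁, hG₂, hG⟩ :=
    exists_fault_zSpider (fun v => flipSet b F x v + a) (∑ e, (F e).2)
  refine ⟨G, mem_possibleFaults_edgeFlip _ _, ?_, ?_⟩
  · rw [weight_edgeFlip, weight_edgeFlip]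
    refine hG.trans (max_le ha ?_)
    rcases bit_cases (∑ e, (F e).2) with hp | hp
    · rw [hp]
      exact Nat.zero_le _
    · rw [hp]
      obtain ⟨e, -, he⟩ := Finset.exists_ne_zero_of_sum_ne_zero (hp.trans_ne one_ne_zero)
      exact Finset.card_pos.2 ⟨e, mem_filter_univ _ |>.2 fun h => he (by rw [h]; rfl)⟩
  · have hGi := interpWithFault_zSpider G
    rw [funext hG₁, hG₂] at hGi
    rcases bit_cases a with rfl | rfl
    · simp only [add_zero] at hGi
      exact .of_sign_smul hk hGi
    · rw [flipMatrix_add_one, smul_smul, ← sign_add] at hGi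
      exact .of_sign_smul hk hGi

end FaultEquivalence

end

end ZXFault

theorem mainTheorem2 (n : ℕ) (hn : 1 ≤ n) (I O : Type) [Fintype I] [Fintype O]
    (b : I ⊕ O ≃ Bool × Fin n) :
    ZXFault.FaultEquivalent
      (ZXFault.zSpider I O) (ZXFault.zSpider I O).edgeFlip
      (ZXFault.splitSpider n b) (ZXFault.splitSpider n b).edgeFlip :=
  fun w => ⟨ZXFault.wFaultLE_zSpider_splitSpider b hn w,
    ZXFault.wFaultLE_splitSpider_zSpider b hn w⟩
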